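/- **Setting.** Fix $d,c\in\mathbb N$ and a set $A\subseteq\{0,1\}^d$ of admissible feature vectors (for example the one-hot vectors, or all of $\{0,1\}^d$). A *graph* is a finite non-empty directed graph $G=(V,E)$, loops allowed, together with a map $f\colon V\to A$; write $N(v)=\{u\in V : (v,u)\in E\}$. Let $\mathcal G_c$ be the class of all graphs with $|N(v)|\le c$ for every $v\in V$ (there is no bound on $|V|$). An *FO classifier* is a first-order formula $\varphi(x)$ with one free variable, with equality, over the vocabulary with a binary edge relation and unary predicates $P_1,\dots,P_d$, where $P_i$ holds at $v$ iff $f(v)[i]=1$. A $\mathrm{GML}^\exists$ *classifier* is a formula of the grammar $$\psi ::= \top \mid p_i \mid \neg\psi \mid \psi\wedge\psi \mid \Diamond_{\ge k}\psi \mid \exists_{\ge k}\psi \qquad (1\le i\le d,\ k\in\mathbb N),$$ where $G,v\models p_i$ iff $f(v)[i]=1$; $G,v\models\Diamond_{\ge k}\psi$ iff at least $k$ vertices $u\in N(v)$ satisfy $G,u\models\psi$; $G,v\models\exists_{\ge k}\psi$ iff at least $k$ vertices $u\in V$ satisfy $G,u\models\psi$; and $\top$, $\neg$, $\wedge$ have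 their usual meaning. An *ACR-GNN* with input dimension $d$ consists of a number $L\in\mathbb N$ of layers, dimensions $d_0=d,d_1,\dots,d_L\in\mathbb N$, arbitrary functions $\mathsf{agg}_i,\mathsf{read}_i$ from finite multisets over $\mathbb R^{d_{i-1}}$ to $\mathbb R^{d_{i-1}}$ and $\mathsf{comb}_i\colon(\mathbb R^{d_{i-1}})^3\to\mathbb R^{d_i}$ for $1\le i\le L$, and an arbitrary function $\mathsf{cls}\colon\mathbb R^{d_L}\to\{0,1\}$. On a graph it computes $f^{(0)}=f$ and $$f^{(i)}(v)=\mathsf{comb}_i\Big(f^{(i-1)}(v),\ \mathsf{agg}_i\{\!\{f^{(i-1)}(u): u\in N(v)\}\!\},\ \mathsf{read}_i\{\!\{f^{(i-1)}(u): u\in V\}\!\}\Big),$$ and it accepts $(G,v)$ iff $\mathsf{cls}(f^{(L)}(v))=1$. **Theorem.** For every FO classifier $\varphi$ the following are equivalent: 1. $\varphi$ is captured by an ACR-GNN over $\mathcal G_c$: there is an ACR-GNN $\mathcal N$ such that for all $G\in\mathcal G_c$ and all vertices $v$ of $G$, $\mathcal N$ accepts $(G,v)$ iff $G,v\models\varphi$.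 2. $\varphi$ is equivalent to a $\mathrm{GML}^\exists$ classifier over $\mathcal G_c$: there is a $\mathrm{GML}^\exists$ classifier $\psi$ such that for all $G\in\mathcal G_c$ and all vertices $v$ of $G$, $G,v\models\varphi$ iff $G,v\models\psi$. -/

import Mathlib

/-- A directed graph on the vertex set `V` (loops are allowed), together with a vector of `d`
binary features at every vertex. Graphs are finite: `Fintype V` is assumed where it is used. -/
structure FeaturedGraph (d : ℕ) (V : Type) where
  Edge : V → V → Prop
  feat : V → Fin d → Bool

namespace FeaturedGraph

variable {d : ℕ} {V : Type}

open Classical in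
/-- The out-neighbourhood `{u | (v, u) is an edge}`. -/
noncomputable def outNbhd [Fintype V] (G : FeaturedGraph d V) (v : V) : Finset V :=
  Finset.univ.filter fun u => G.Edge v u

/-- Every vertex has at most `c` out-neighbours. -/
def DegreeAtMost [Fintype V] (G : FeaturedGraph d V) (c : ℕ) : Prop :=
  ∀ v, (G.outNbhd v).card ≤ c

/-- Every feature vector of `G` lies in `A`. -/
def FeaturesIn (G : FeaturedGraph d V) (A : Set (Fin d → Bool)) : Prop :=
  ∀ v, G.feat v ∈ A

end FeaturedGraph

/-! ### Aggregate-combine-readout graph neural networks -/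

/-- An ACR-GNN with input dimension `d`. Layer `i : Fin L` maps vectors of dimension
`dim i.castSucc` to vectors of dimension `dim i.succ`. -/
structure ACRGNN (d : ℕ) where
  L : ℕ
  dim : Fin (L + 1) → ℕ
  dim_zero : dim 0 = d
  comb : (i : Fin L) → (Fin (dim i.castSucc) → ℝ) → (Fin (dim i.castSucc) → ℝ) →
    (Fin (dim i.castSucc) → ℝ) → (Fin (dim i.succ) → ℝ)
  agg : (i : Fin L) → Multiset (Fin (dim i.castSucc) → ℝ) → (Fin (dim i.castSucc) → ℝ)
  read : (i : Fin L) → Multiset (Fin (dim i.castSucc) → ℝ) → (Fin (dim i.castSucc) → ℝ)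
  cls : (Fin (dim (Fin.last L)) → ℝ) → Bool

namespace ACRGNN

variable {d : ℕ} {V : Type} [Fintype V]

/-- The initial embedding: the feature vector of `v`, read as a vector of zeros and ones. -/
def init (N : ACRGNN d) (G : FeaturedGraph d V) (v : V) : Fin (N.dim 0) → ℝ :=
  fun j => if G.feat v (Fin.cast N.dim_zero j) = true then 1 else 0

/-- One layer. -/
noncomputable def step (N : ACRGNN d) (G : FeaturedGraph d V) (i : Fin N.L)
    (f : V → Fin (N.dim i.castSucc) → ℝ) (v : V) : Fin (N.dim i.succ) → ℝ :=
  N.comb i (f v) (N.agg i ((G.outNbhd v).val.map f))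
    (N.read i ((Finset.univ : Finset V).val.map f))

/-- The embedding computed by the first `i` layers. -/
noncomputable def embed (N : ACRGNN d) (G : FeaturedGraph d V) (i : Fin (N.L + 1)) :
    V → Fin (N.dim i) → ℝ :=
  Fin.induction (motive := fun i => V → Fin (N.dim i) → ℝ) (N.init G) (N.step G) i

/-- `N` accepts the pointed graph `(G, v)`. -/
def Accepts (N : ACRGNN d) (G : FeaturedGraph d V) (v : V) : Prop :=
  N.cls (N.embed G (Fin.last N.L) v) = true

end ACRGNN

/-! ### Graded modal logic with graded global modalities -/

/-- Formulas of `d`-dimensional graded modal logic with graded global modalities. -/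
inductive GMLE (d : ℕ) : Type
  | top : GMLE d
  | prop : Fin d → GMLE d
  | neg : GMLE d → GMLE d
  | and : GMLE d → GMLE d → GMLE d
  /-- at least `k` out-neighbours satisfy the formula -/
  | dia : ℕ → GMLE d → GMLE d
  /-- at least `k` vertices satisfy the formula -/
  | ex : ℕ → GMLE d → GMLE d

namespace GMLE

variable {d : ℕ} {V : Type} [Fintype V]

open Classical in
/-- Satisfaction of a formula at a vertex. -/
def Sat (G : FeaturedGraph d V) : GMLE d → V → Prop
  | top, _ => True
  | prop i, v => G.feat v i = true
  | neg φ, v => ¬ Sat G φ v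
  | and φ ψ, v => Sat G φ v ∧ Sat G ψ v
  | dia k φ, v => k ≤ ((G.outNbhd v).filter fun u => Sat G φ u).card
  | ex k φ, _ => k ≤ ((Finset.univ : Finset V).filter fun u => Sat G φ u).card

end GMLE

/-! ### First-order logic -/

/-- The relation symbols: one unary symbol for each of the `d` features, and a binary symbol. -/
inductive GraphRel (d : ℕ) : ℕ → Type
  | feature : Fin d → GraphRel d 1
  | edge : GraphRel d 2

/-- The (relational) first-order language of `d`-featured graphs. Equality is a logical symbol. -/
def graphLang (d : ℕ) : FirstOrder.Language where
  Functions := fun _ => Empty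
  Relations := GraphRel d

/-- A featured graph as a first-order structure. -/
@[reducible]
def FeaturedGraph.toStructure {d : ℕ} {V : Type} (G : FeaturedGraph d V) :
    (graphLang d).Structure V where
  funMap := fun f => nomatch f
  RelMap := fun R x => match R with
    | GraphRel.feature i => G.feat (x 0) i = true
    | GraphRel.edge => G.Edge (x 0) (x 1)

/-- A first-order classifier: a first-order formula with one free variable. -/
abbrev FOClassifier (d : ℕ) := (graphLang d).Formula (Fin 1)

/-- The vertex `v` of `G` satisfies the first-order classifier `φ`. -/
def FOClassifier.Sat {d : ℕ} {V : Type} (G : FeaturedGraph d V) (φ : FOClassifier d) (v : V) :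
    Prop :=
  letI := G.toStructure
  φ.Realize fun _ => v

/-! ### Capturing and equivalence over graphs of degree at most `c` -/

/-- `N` captures `φ` over the finite graphs of degree at most `c` with feature vectors in `A`. -/
def CapturedBy {d : ℕ} (A : Set (Fin d → Bool)) (c : ℕ) (φ : FOClassifier d) (N : ACRGNN d) :
    Prop :=
  ∀ (V : Type) [Fintype V] (G : FeaturedGraph d V), G.FeaturesIn A → G.DegreeAtMost c →
    ∀ v : V, N.Accepts G v ↔ φ.Sat G v

/-- `φ` and `ψ` are equivalent over the finite graphs of degree at most `c` with feature vectors
in `A`. -/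
def EquivalentTo {d : ℕ} (A : Set (Fin d → Bool)) (c : ℕ) (φ : FOClassifier d) (ψ : GMLE d) :
    Prop :=
  ∀ (V : Type) [Fintype V] (G : FeaturedGraph d V), G.FeaturesIn A → G.DegreeAtMost c →
    ∀ v : V, φ.Sat G v ↔ ψ.Sat G v

open FirstOrder Language

/-! From formulas to networks: a network whose layers code their whole input injectively into an
integer separates any two pointed graphs that a formula of smaller modal depth separates, so an
arbitrary classification function can decide the formula.

From networks to formulas: run colour refinement along out-edges only, and record global information
as the census, the multiset of all colours. Colour and census determine the output of a network with
at most that many layers (`FeaturedGraph.embed_eq_of_census_eq`), so a captured `φ` depends only on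
them. Being first-order, `φ` should moreover see the census only up to a threshold. The obstacle is
that vertices of one colour need not be interchangeable. Since `φ` is captured, `G` may be replaced
by any admissible graph with the same colours; `FeaturedGraph.rewire` redirects all edges to the
first few vertices of each colour. All but at most `c` vertices of a colour then become twins
without incoming edges, and a first-order formula cannot detect one more twin among many
(`FeaturedGraph.exists_realize_addTwin_iff`). Hence frequent colours can be made more frequent, and
two graphs whose truncated censuses agree can be enlarged to have equal censuses
(`CapturedBy.exists_threshold`).

Bounded degree leaves finitely many colours, each definable by a formula. So finitely many formulas
determine `φ`, and a Boolean combination of them defines it. -/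

theorem Multiset.map_eq_map_of_factor {α β γ δ : Type*} {s : Multiset α} {t : Multiset β}
    {f : α → γ} {g : β → γ} {f' : α → δ} {g' : β → δ} (h : s.map f = t.map g)
    (hfg : ∀ a b, f a = g b → f' a = g' b) : s.map f' = t.map g' := by
  rw [← Multiset.rel_eq, Multiset.rel_map] at h ⊢
  exact h.mono fun a _ b _ => hfg a b

theorem Finset.count_map_val {α β : Type*} [DecidableEq β] (s : Finset α) (f : α → β) (b : β) :
    (s.val.map f).count b = (s.filter fun a => f a = b).card := by
  rw [Multiset.count_map, Finset.card_def, Finset.filter_val]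
  congr 1
  exact Multiset.filter_congr fun a _ => eq_comm

open Classical in
theorem Finset.card_filter_eq_of_map_eq {α β : Type*} {s : Finset α} {t : Finset β}
    {p : α → Prop} {q : β → Prop} (h : s.val.map p = t.val.map q) :
    (s.filter p).card = (t.filter q).card := by
  have h1 := congrArg (Multiset.count True) h
  rw [Finset.count_map_val, Finset.count_map_val] at h1
  simpa using h1

namespace GMLE

/-- The nesting depth of modalities. -/
def depth {d : ℕ} : GMLE d → ℕ
  | top => 0
  | prop _ => 0
  | neg φ => φ.depth
  | and φ ψ => max φ.depth ψ.depth
  | dia _ φ => φ.depth + 1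
  | ex _ φ => φ.depth + 1

end GMLE

/-! ### A universal network -/

namespace ACRGNN

/-- An injective code for real vectors with integer entries. -/
noncomputable def code {n : ℕ} (x : Fin n → ℝ) : ℕ :=
  Encodable.encode (List.ofFn fun j => ⌊x j⌋)

/-- The network with `L` layers which keeps all the information that a network can keep. -/
noncomputable def universal (d L : ℕ)
    (cls : (Fin ((Fin.cases d fun _ => 1 : Fin (L + 1) → ℕ) (Fin.last L)) → ℝ) → Bool) :
    ACRGNN d where
  L := L
  dim := Fin.cases d fun _ => 1
  dim_zero := rfl
  comb _ x y z := fun _ => (Encodable.encode (code x, code y, code z) : ℕ)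
  agg _ M := fun _ => (Encodable.encode (M.map code) : ℕ)
  read _ M := fun _ => (Encodable.encode (M.map code) : ℕ)
  cls := cls

theorem code_const_injective {n : ℕ} (hn : 0 < n) {a b : ℕ}
    (h : code (fun _ : Fin n => (a : ℝ)) = code (fun _ : Fin n => (b : ℝ))) : a = b := by
  have h1 := List.ofFn_injective (Encodable.encode_injective h)
  simpa using congrFun h1 ⟨0, hn⟩

theorem code_const_eq {n : ℕ} {a b : ℕ}
    (h : code (fun _ : Fin n => (a : ℝ)) = code (fun _ : Fin n => (b : ℝ))) :
    (fun _ : Fin n => (a : ℝ)) = fun _ => (b : ℝ) := by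
  funext j
  rw [code_const_injective j.pos h]

theorem embed_succ {d : ℕ} {V : Type} [Fintype V] (N : ACRGNN d) (G : FeaturedGraph d V)
    (i : Fin N.L) : N.embed G i.succ = N.step G i (N.embed G i.castSucc) :=
  Fin.induction_succ ..

theorem code_universal_init {d L : ℕ}
    {cls : (Fin ((Fin.cases d fun _ => 1 : Fin (L + 1) → ℕ) (Fin.last L)) → ℝ) → Bool}
    {V W : Type} {G : FeaturedGraph d V} {H : FeaturedGraph d W} {v : V} {w : W}
    (h : code ((universal d L cls).init G v) = code ((universal d L cls).init H w)) :
    G.feat v = H.feat w := by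
  have h1 := List.ofFn_injective (Encodable.encode_injective h)
  funext j
  have h2 := congrFun h1 j
  change ⌊(if G.feat v j = true then (1 : ℝ) else 0)⌋ =
    ⌊(if H.feat w j = true then (1 : ℝ) else 0)⌋ at h2
  cases hv : G.feat v j <;> cases hw : H.feat w j <;> simp [hv, hw] at h2 ⊢

variable {d L : ℕ} {V W : Type} [Fintype V] [Fintype W] {G : FeaturedGraph d V}
  {H : FeaturedGraph d W}
  {cls : (Fin ((Fin.cases d fun _ => 1 : Fin (L + 1) → ℕ) (Fin.last L)) → ℝ) → Bool}

/-- The first layer is exempt from the second claim: its aggregates live in dimension `d`, and for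
`d = 0` they carry no information. Later layers have input dimension 1. -/
theorem universal_step_inj (i : Fin (universal d L cls).L)
    {f : V → Fin ((universal d L cls).dim i.castSucc) → ℝ}
    {g : W → Fin ((universal d L cls).dim i.castSucc) → ℝ} {v : V} {w : W}
    (h : (universal d L cls).step G i f v = (universal d L cls).step H i g w) :
    code (f v) = code (g w) ∧ (0 < i.val →
      (G.outNbhd v).val.map (fun u => code (f u)) = (H.outNbhd w).val.map (fun u => code (g u)) ∧
      (Finset.univ : Finset V).val.map (fun u => code (f u)) =
        (Finset.univ : Finset W).val.map (fun u => code (g u))) := by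
  have h0 := congrFun h (0 : Fin 1)
  have h1 := Encodable.encode_injective (Nat.cast_injective (R := ℝ) h0)
  simp only [Prod.mk.injEq] at h1
  obtain ⟨hc, ha, hr⟩ := h1
  refine ⟨hc, fun hi => ?_⟩
  have hpos : 0 < (universal d L cls).dim i.castSucc := by
    obtain ⟨_ | i, hi'⟩ := i
    · simp at hi
    · exact Nat.one_pos
  have ha' := Encodable.encode_injective (code_const_injective hpos ha)
  have hr' := Encodable.encode_injective (code_const_injective hpos hr)
  exact ⟨(Multiset.map_map code ..).symm.trans (ha'.trans (Multiset.map_map code ..)),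
    (Multiset.map_map code ..).symm.trans (hr'.trans (Multiset.map_map code ..))⟩

theorem code_universal_embed_succ (i : Fin (universal d L cls).L) {v : V} {w : W}
    (h : code ((universal d L cls).embed G i.succ v) =
      code ((universal d L cls).embed H i.succ w)) :
    (universal d L cls).step G i ((universal d L cls).embed G i.castSucc) v =
      (universal d L cls).step H i ((universal d L cls).embed H i.castSucc) w := by
  rw [embed_succ, embed_succ] at h
  exact code_const_eq h

theorem feat_eq_of_code_universal_embed (i : Fin ((universal d L cls).L + 1)) {v : V} {w : W}
    (h : code ((universal d L cls).embed G i v) = code ((universal d L cls).embed H i w)) :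
    G.feat v = H.feat w := by
  induction i using Fin.induction generalizing v w with
  | zero => exact code_universal_init h
  | succ i ih => exact ih (universal_step_inj i (code_universal_embed_succ i h)).1

/-- Each modality consumes one layer, whose code reveals the multisets of previous codes. The
inequality is strict because the first layer may lose its multisets. -/
theorem sat_iff_of_code_universal_embed (ψ : GMLE d) (i : Fin ((universal d L cls).L + 1))
    (hi : ψ.depth < i.val) {v : V} {w : W}
    (h : code ((universal d L cls).embed G i v) = code ((universal d L cls).embed H i w)) :
    ψ.Sat G v ↔ ψ.Sat H w := by
  induction ψ generalizing i v w with
  | top => simp [GMLE.Sat]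
  | prop j => simp [GMLE.Sat, feat_eq_of_code_universal_embed i h]
  | neg φ ih => simpa [GMLE.Sat] using not_congr (ih i hi h)
  | and φ ψ ih1 ih2 =>
    simp only [GMLE.depth, max_lt_iff] at hi
    simp [GMLE.Sat, ih1 i hi.1 h, ih2 i hi.2 h]
  | dia k φ ih =>
    simp only [GMLE.depth] at hi
    induction i using Fin.cases with
    | zero => simp at hi
    | succ i =>
      have hi' : φ.depth < i.val := by simpa using hi
      have h1 := ((universal_step_inj i (code_universal_embed_succ i h)).2 (by omega)).1
      have h2 := Multiset.map_eq_map_of_factor h1 (f' := φ.Sat G) (g' := φ.Sat H)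
        fun a b hab => propext (ih i.castSucc (by simpa using hi') hab)
      simp only [GMLE.Sat]
      rw [Finset.card_filter_eq_of_map_eq h2]
  | ex k φ ih =>
    simp only [GMLE.depth] at hi
    induction i using Fin.cases with
    | zero => simp at hi
    | succ i =>
      have hi' : φ.depth < i.val := by simpa using hi
      have h1 := ((universal_step_inj i (code_universal_embed_succ i h)).2 (by omega)).2
      have h2 := Multiset.map_eq_map_of_factor h1 (f' := φ.Sat G) (g' := φ.Sat H)
        fun a b hab => propext (ih i.castSucc (by simpa using hi') hab)
      simp only [GMLE.Sat]
      rw [Finset.card_filter_eq_of_map_eq h2]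

open Classical in
/-- Every formula of graded modal logic with graded global modalities is computed by a network. -/
theorem exists_accepts_iff_sat (ψ : GMLE d) :
    ∃ N : ACRGNN d, ∀ (V : Type) [Fintype V] (G : FeaturedGraph d V) (v : V),
      N.Accepts G v ↔ ψ.Sat G v := by
  let L := ψ.depth + 1
  -- Embeddings do not depend on `cls`, so a dummy classifier can be used to define the real one:
  -- accept a vector if it arises from some pointed graph satisfying `ψ`.
  refine ⟨universal d L fun x => decide (∃ (W : Type) (_ : Fintype W) (H : FeaturedGraph d W)
    (w : W), (universal d L fun _ => false).embed H (Fin.last L) w = x ∧ ψ.Sat H w), ?_⟩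
  intro V _ G v
  refine decide_eq_true_iff.trans ⟨?_, fun h => ⟨V, inferInstance, G, v, rfl, h⟩⟩
  rintro ⟨W, _, H, w, hw, hs⟩
  have hw' : (universal d L fun _ => false).embed H (Fin.last L) w =
    (universal d L fun _ => false).embed G (Fin.last L) v := hw
  exact (sat_iff_of_code_universal_embed ψ (Fin.last L) (Nat.lt_succ_self _)
    (congrArg code hw')).1 hs

end ACRGNN

/-! ### Colour refinement and censuses -/

/-- The values of `i` rounds of local colour refinement. -/
def WLType (d : ℕ) : ℕ → Type
  | 0 => Fin d → Bool
  | i + 1 => WLType d i × Multiset (WLType d i)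

namespace FeaturedGraph

variable {d : ℕ} {V W : Type} [Fintype V] [Fintype W]

theorem mem_outNbhd {G : FeaturedGraph d V} {v u : V} : u ∈ G.outNbhd v ↔ G.Edge v u := by
  simp [outNbhd]

/-- The colour of a vertex after `i` rounds of local colour refinement. -/
noncomputable def wl (G : FeaturedGraph d V) : (i : ℕ) → V → WLType d i
  | 0, v => G.feat v
  | i + 1, v => (wl G i v, (G.outNbhd v).val.map (wl G i))

theorem wl_eq_of_succ {G : FeaturedGraph d V} {H : FeaturedGraph d W} {i : ℕ} {v : V} {w : W}
    (h : G.wl (i + 1) v = H.wl (i + 1) w) :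
    G.wl i v = H.wl i w ∧
      (G.outNbhd v).val.map (G.wl i) = (H.outNbhd w).val.map (H.wl i) :=
  Prod.ext_iff.1 h

theorem wl_eq_of_le {G : FeaturedGraph d V} {H : FeaturedGraph d W} {i j : ℕ} (hij : i ≤ j)
    {v : V} {w : W} (h : G.wl j v = H.wl j w) : G.wl i v = H.wl i w := by
  induction j, hij using Nat.le_induction with
  | base => exact h
  | succ j _ ih => exact ih (wl_eq_of_succ h).1

/-- The multiset of all colours after `i` rounds. -/
noncomputable def census (G : FeaturedGraph d V) (i : ℕ) : Multiset (WLType d i) :=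
  (Finset.univ : Finset V).val.map (G.wl i)

/-- A single late census serves every readout, because later colours refine earlier ones. -/
theorem embed_eq_of_census_eq {G : FeaturedGraph d V} {H : FeaturedGraph d W} (N : ACRGNN d)
    {k : ℕ} (hk : N.L ≤ k) (hc : G.census k = H.census k) (i : Fin (N.L + 1)) {v : V} {w : W}
    (h : G.wl i v = H.wl i w) : N.embed G i v = N.embed H i w := by
  induction i using Fin.induction generalizing v w with
  | zero =>
    have h0 : G.feat v = H.feat w := h
    change N.init G v = N.init H w
    funext j
    simp [ACRGNN.init, h0]
  | succ i ih =>
    rw [ACRGNN.embed_succ, ACRGNN.embed_succ]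
    obtain ⟨h1, h2⟩ := wl_eq_of_succ h
    simp only [ACRGNN.step]
    rw [ih h1, Multiset.map_eq_map_of_factor h2 (f' := N.embed G i.castSucc)
      (g' := N.embed H i.castSucc) fun a b hab => ih hab,
      Multiset.map_eq_map_of_factor hc (f' := N.embed G i.castSucc)
      (g' := N.embed H i.castSucc) fun a b hab => ih (wl_eq_of_le ?_ hab)]
    exact i.castSucc.is_le.trans hk

theorem accepts_iff_of_census_eq {G : FeaturedGraph d V} {H : FeaturedGraph d W} (N : ACRGNN d)
    {k : ℕ} (hk : N.L ≤ k) (hc : G.census k = H.census k) {v : V} {w : W}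
    (h : G.wl k v = H.wl k w) : N.Accepts G v ↔ N.Accepts H w := by
  unfold ACRGNN.Accepts
  rw [embed_eq_of_census_eq N hk hc (Fin.last N.L) (v := v) (w := w) (wl_eq_of_le hk h)]

/-- Colours are preserved by maps that respect features and, up to colours, neighbourhoods. -/
theorem wl_comp {G : FeaturedGraph d V} {H : FeaturedGraph d W} (p : W → V) (k : ℕ)
    (hf : ∀ w, H.feat w = G.feat (p w))
    (hn : ∀ w, (H.outNbhd w).val.map (fun u => G.wl k (p u)) =
      (G.outNbhd (p w)).val.map (G.wl k)) {i : ℕ} (hi : i ≤ k + 1) (w : W) :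
    H.wl i w = G.wl i (p w) := by
  induction i generalizing w with
  | zero => exact hf w
  | succ i ih =>
    refine Prod.ext (ih (by omega) w) ?_
    exact Multiset.map_eq_map_of_factor (hn w) fun a b hab =>
      (ih (by omega) a).trans (wl_eq_of_le (by omega) hab)

/-! ### Adding a twin -/

/-- Add a new vertex with the features and the out-neighbours of `w`, and without incoming edges. -/
def addTwin (G : FeaturedGraph d V) (w : V) : FeaturedGraph d (Option V) where
  Edge a b := ∃ b', b = some b' ∧ G.Edge (a.getD w) b'
  feat a := G.feat (a.getD w)

theorem outNbhd_addTwin (G : FeaturedGraph d V) (w : V) (a : Option V) :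
    (G.addTwin w).outNbhd a = (G.outNbhd (a.getD w)).map Function.Embedding.some := by
  ext b
  simp [mem_outNbhd, addTwin, eq_comm, and_comm]

theorem wl_addTwin (G : FeaturedGraph d V) (w : V) (i : ℕ) (a : Option V) :
    (G.addTwin w).wl i a = G.wl i (a.getD w) := by
  refine wl_comp (G := G) (H := G.addTwin w) (fun a => a.getD w) i (fun _ => rfl) (fun a => ?_) i.le_succ a
  simp [outNbhd_addTwin]

theorem census_addTwin (G : FeaturedGraph d V) (w : V) (i : ℕ) :
    (G.addTwin w).census i = G.wl i w ::ₘ G.census i := by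
  have h : (G.addTwin w).wl i = fun a => G.wl i (a.getD w) := funext (wl_addTwin G w i)
  simp [census, h, univ_option, Finset.insertNone]

theorem DegreeAtMost.addTwin {G : FeaturedGraph d V} {c : ℕ} (h : G.DegreeAtMost c) (w : V) :
    (G.addTwin w).DegreeAtMost c := fun a => by
  rw [outNbhd_addTwin, Finset.card_map]
  exact h _

end FeaturedGraph

/-! ### First-order logic and twins -/

namespace FeaturedGraph

/-- `a` and `b` have the same features and out-neighbours, and `a` has no incoming edge. -/
def IsTwin {d : ℕ} {V : Type} (G : FeaturedGraph d V) (a b : V) : Prop :=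
  G.feat a = G.feat b ∧ (∀ u, G.Edge a u ↔ G.Edge b u) ∧ ∀ u, ¬ G.Edge u a

variable {d : ℕ} {V : Type}

theorem addTwin_edge_some_iff {G : FeaturedGraph d V} {w b : V} {a : Option V} :
    (G.addTwin w).Edge a (some b) ↔ G.Edge (a.getD w) b := by
  simp [addTwin]

theorem not_addTwin_edge_none {G : FeaturedGraph d V} {w : V} {a : Option V} :
    ¬ (G.addTwin w).Edge a none := by
  simp [addTwin]

open Classical in
/-- Exchanging the new twin of `w` with an old one. -/
noncomputable def swapTwin (G : FeaturedGraph d V) {a w : V} (h : G.IsTwin a w) :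
    letI := (G.addTwin w).toStructure
    Option V ≃[graphLang d] Option V :=
  letI := (G.addTwin w).toStructure
  { Equiv.swap (none : Option V) (some a) with
    map_fun' := fun f => nomatch f
    map_rel' := by
      have hE : ∀ x y, (G.addTwin w).Edge (Equiv.swap (none : Option V) (some a) x)
          (Equiv.swap (none : Option V) (some a) y) ↔ (G.addTwin w).Edge x y := by
        intro x y
        rcases eq_or_ne y none with rfl | hy
        · simp [addTwin_edge_some_iff, not_addTwin_edge_none, h.2.2]
        rcases eq_or_ne y (some a) with rfl | hy'
        · simp [addTwin_edge_some_iff, not_addTwin_edge_none, h.2.2]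
        rw [Equiv.swap_apply_of_ne_of_ne hy hy']
        obtain ⟨y, rfl⟩ := Option.ne_none_iff_exists'.1 hy
        rw [addTwin_edge_some_iff, addTwin_edge_some_iff]
        rcases eq_or_ne x none with rfl | hx
        · simpa using h.2.1 y
        rcases eq_or_ne x (some a) with rfl | hx'
        · simpa using (h.2.1 y).symm
        rw [Equiv.swap_apply_of_ne_of_ne hx hx']
      have hF : ∀ x, (G.addTwin w).feat (Equiv.swap (none : Option V) (some a) x) =
          (G.addTwin w).feat x := by
        intro x
        rcases eq_or_ne x none with rfl | hx
        · simpa [addTwin] using h.1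
        rcases eq_or_ne x (some a) with rfl | hx'
        · simpa [addTwin] using h.1.symm
        rw [Equiv.swap_apply_of_ne_of_ne hx hx']
      intro n R x
      cases R with
      | feature i => exact iff_of_eq (congrArg (fun g => g i = true) (hF (x 0)))
      | edge => exact hE _ _ }

/-- The inclusion of a graph into the graph with an additional twin. -/
def addTwinEmbedding (G : FeaturedGraph d V) (w : V) :
    letI := G.toStructure
    letI := (G.addTwin w).toStructure
    V ↪[graphLang d] Option V :=
  letI := G.toStructure
  letI := (G.addTwin w).toStructure
  { Function.Embedding.some with
    map_fun' := fun f => nomatch f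
    map_rel' := by
      intro n R x
      cases R with
      | feature i => exact Iff.rfl
      | edge => exact addTwin_edge_some_iff }

/-- A first-order formula does not notice that one more twin is added to many twins. -/
theorem exists_realize_addTwin_iff {α : Type} {n : ℕ} (φ : (graphLang d).BoundedFormula α n) :
    ∃ K : ℕ, ∀ (V : Type) (G : FeaturedGraph d V) (w : V) (S : Finset V) (v : α → V)
      (xs : Fin n → V), K ≤ S.card →
      (∀ a ∈ S, G.IsTwin a w ∧ (∀ i, v i ≠ a) ∧ ∀ i, xs i ≠ a) →
      letI := G.toStructure
      letI := (G.addTwin w).toStructure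
      (φ.Realize v xs ↔ φ.Realize (fun i => some (v i)) (fun i => some (xs i))) := by
  induction φ with
  | falsum => exact ⟨0, fun V G w S v xs _ _ => Iff.rfl⟩
  | equal t₁ t₂ =>
    refine ⟨0, fun V G w S v xs _ _ => ?_⟩
    let _ := G.toStructure
    let _ := (G.addTwin w).toStructure
    have e : (Sum.elim (fun i => some (v i)) fun i => some (xs i)) =
      (G.addTwinEmbedding w) ∘ Sum.elim v xs := by
      funext i; cases i <;> rfl
    simp only [BoundedFormula.Realize, e, HomClass.realize_term]
    exact (G.addTwinEmbedding w).injective.eq_iff.symm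
  | rel R ts =>
    refine ⟨0, fun V G w S v xs _ _ => ?_⟩
    let _ := G.toStructure
    let _ := (G.addTwin w).toStructure
    have e : (Sum.elim (fun i => some (v i)) fun i => some (xs i)) =
      (G.addTwinEmbedding w) ∘ Sum.elim v xs := by
      funext i; cases i <;> rfl
    simp only [BoundedFormula.Realize, e, HomClass.realize_term]
    exact ((G.addTwinEmbedding w).map_rel R _).symm
  | imp φ ψ ih₁ ih₂ =>
    obtain ⟨K₁, h₁⟩ := ih₁
    obtain ⟨K₂, h₂⟩ := ih₂
    refine ⟨max K₁ K₂, fun V G w S v xs hK hS => ?_⟩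
    let _ := G.toStructure
    let _ := (G.addTwin w).toStructure
    exact imp_congr (h₁ V G w S v xs (le_of_max_le_left hK) hS)
      (h₂ V G w S v xs (le_of_max_le_right hK) hS)
  | all φ ih =>
    obtain ⟨K, h⟩ := ih
    refine ⟨K + 1, fun V G w S v xs hK hS => ?_⟩
    let _ := G.toStructure
    let _ := (G.addTwin w).toStructure
    classical
    have key : ∀ x, φ.Realize v (Fin.snoc xs x) ↔
        φ.Realize (fun i => some (v i)) (Fin.snoc (fun i => some (xs i)) (some x) :
          Fin _ → Option V) := by
      intro x
      have e : (Fin.snoc (fun i => some (xs i)) (some x) : Fin _ → Option V) =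
          fun i => some ((Fin.snoc xs x : Fin _ → V) i) :=
        (Fin.comp_snoc some xs x).symm
      rw [e]
      -- The quantified vertex becomes a parameter, which the twins in `S` must avoid; this costs
      -- one twin per quantifier.
      refine h V G w (S.erase x) v _ ?_ fun a ha => ?_
      · have := S.pred_card_le_card_erase (a := x)
        omega
      · obtain ⟨hax, ha⟩ := Finset.mem_erase.1 ha
        refine ⟨(hS a ha).1, (hS a ha).2.1, fun i => ?_⟩
        induction i using Fin.lastCases with
        | last => simpa using hax.symm
        | cast i => simpa using (hS a ha).2.2 i
    refine ⟨fun hG y => ?_, fun hH x => (key x).2 (hH (some x))⟩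
    rcases y with _ | y
    -- The new vertex is exchanged with an unused old twin by an automorphism fixing all parameters,
    -- which reduces to the case of an old vertex.
    · obtain ⟨a, ha⟩ : S.Nonempty := Finset.card_pos.1 (by omega)
      obtain ⟨ht, hv, hx⟩ := hS a ha
      have h1 := (key a).1 (hG a)
      rw [← StrongHomClass.realize_boundedFormula (G.swapTwin ht)] at h1
      have hsome : ∀ b, b ≠ a → G.swapTwin ht (some b) = some b := fun b hb =>
        Equiv.swap_apply_of_ne_of_ne (by simp) (by simpa using hb)
      have hlast : G.swapTwin ht (some a) = none := Equiv.swap_apply_right _ _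
      rw [Fin.comp_snoc, hlast] at h1
      have e₁ : (G.swapTwin ht ∘ fun i => some (v i)) = fun i => some (v i) :=
        funext fun i => hsome _ (hv i)
      have e₂ : (G.swapTwin ht ∘ fun i => some (xs i)) = fun i => some (xs i) :=
        funext fun i => hsome _ (hx i)
      rwa [e₁, e₂] at h1
    · exact (key y).1 (hG y)

end FeaturedGraph

/-! ### Rewiring edges to create twins -/

open Classical in
/-- The elements of every fibre can be numbered. -/
theorem Finset.exists_index_fibre {V S : Type*} [Fintype V] (f : V → S) :
    ∃ idx : V → ℕ, ∀ s k, k ≤ (univ.filter fun u => f u = s).card →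
      (univ.filter fun u => f u = s ∧ idx u < k).card = k := by
  let e (s : S) := Fintype.equivFin {u // f u = s}
  let idx (u : V) : ℕ := e (f u) ⟨u, rfl⟩
  have hidx : ∀ s (u : {u // f u = s}), idx u = e s u := by
    rintro s ⟨u, rfl⟩
    rfl
  refine ⟨idx, fun s k hk => ?_⟩
  rw [← Fintype.card_subtype] at hk
  conv_rhs => rw [← card_range k]
  refine card_nbij idx (fun u hu => ?_) (fun u hu u' hu' h => ?_) fun j hj => ?_
  · simp only [coe_filter, mem_univ, true_and, Set.mem_ofPred_eq, coe_range,
      Set.mem_Iio] at hu ⊢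
    exact hu.2
  · simp only [coe_filter, mem_univ, true_and, Set.mem_ofPred_eq] at hu hu'
    have h1 := hidx s ⟨u, hu.1⟩
    have h2 := hidx s ⟨u', hu'.1⟩
    have h3 : e s ⟨u, hu.1⟩ = e s ⟨u', hu'.1⟩ := Fin.ext (h1.symm.trans (h.trans h2))
    exact congrArg Subtype.val ((e s).injective h3)
  · have hj : j < k := by simpa using hj
    let u := (e s).symm ⟨j, hj.trans_le hk⟩
    have hu : idx u = j := by
      rw [hidx s u]
      simp [u]
    exact ⟨u, by simpa [hu] using ⟨u.2, hj⟩, hu⟩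

namespace FeaturedGraph

variable {d : ℕ} {V : Type} [Fintype V]

open Classical in
/-- Replace the out-neighbours of every vertex by the first vertices of the same `k`-round
colours. -/
noncomputable def rewire (G : FeaturedGraph d V) (k : ℕ) (idx : V → ℕ) : FeaturedGraph d V where
  Edge v u := idx u < ((G.outNbhd v).val.map (G.wl k)).count (G.wl k u)
  feat := G.feat

open Classical in
/-- A numbering of the vertices of every `k`-round colour. -/
def IsIndex (G : FeaturedGraph d V) (k : ℕ) (idx : V → ℕ) : Prop :=
  ∀ s m, m ≤ (Finset.univ.filter fun u => G.wl k u = s).card →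
    (Finset.univ.filter fun u => G.wl k u = s ∧ idx u < m).card = m

variable {G : FeaturedGraph d V} {k : ℕ} {idx : V → ℕ}

/-- If `v` has `m` out-neighbours of some colour, that colour has at least `m` vertices, and exactly
`m` of them have index below `m`. -/
theorem map_outNbhd_rewire (h : G.IsIndex k idx) (v : V) :
    ((G.rewire k idx).outNbhd v).val.map (G.wl k) = (G.outNbhd v).val.map (G.wl k) := by
  classical
  ext s
  rw [Finset.count_map_val]
  set m := ((G.outNbhd v).val.map (G.wl k)).count s with hm
  have hle : m ≤ (Finset.univ.filter fun u => G.wl k u = s).card := by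
    rw [hm, Finset.count_map_val]
    exact Finset.card_le_card (Finset.filter_subset_filter _ (Finset.subset_univ _))
  rw [← h s m hle]
  congr 1
  ext u
  simp only [Finset.mem_filter, mem_outNbhd, rewire, Finset.mem_univ, true_and]
  constructor
  · rintro ⟨h1, rfl⟩
    exact ⟨rfl, h1⟩
  · rintro ⟨rfl, h1⟩
    exact ⟨h1, rfl⟩

theorem wl_rewire (h : G.IsIndex k idx) : (G.rewire k idx).wl (k + 1) = G.wl (k + 1) :=
  funext fun v => wl_comp (G := G) (H := G.rewire k idx) id k (fun _ => rfl)
    (map_outNbhd_rewire h) le_rfl v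

theorem degreeAtMost_rewire (h : G.IsIndex k idx) {c : ℕ} (hc : G.DegreeAtMost c) :
    (G.rewire k idx).DegreeAtMost c := fun v => by
  have := congrArg Multiset.card (map_outNbhd_rewire h v)
  rw [Multiset.card_map, Multiset.card_map] at this
  exact (le_of_eq this).trans (hc v)

/-- After rewiring, the out-neighbours of a vertex depend only on how many it had of each `k`-round
colour, which its colour one round later records. No such number exceeds `c`, so indices from `c` on
are never targets. -/
theorem isTwin_rewire {c : ℕ} (hc : G.DegreeAtMost c) {a b : V}
    (hab : G.wl (k + 1) a = G.wl (k + 1) b) (ha : c ≤ idx a) : (G.rewire k idx).IsTwin a b := by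
  classical
  refine ⟨?_, fun u => ?_, fun u hu => ?_⟩
  · exact wl_eq_of_le (G := G) (H := G) (i := 0) (Nat.zero_le _) hab
  · simp only [rewire, (wl_eq_of_succ hab).2]
  · have h1 : ((G.outNbhd u).val.map (G.wl k)).count (G.wl k a) ≤ c :=
      (Multiset.count_le_card _ _).trans (by simpa using hc u)
    exact absurd hu (not_lt.2 (h1.trans ha))

-- Vertices of colour `t` share the `k`-round colour `t.1`, and at most `c` vertices of that colour
-- have index below `c`.
open Classical in
theorem card_twins {c : ℕ} (h : G.IsIndex k idx) (t : WLType d (k + 1)) :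
    (G.census (k + 1)).count t ≤
      (Finset.univ.filter fun u => G.wl (k + 1) u = t ∧ c ≤ idx u).card + c := by
  rw [census, Finset.count_map_val,
    ← Finset.card_filter_add_card_filter_not (s := Finset.univ.filter fun u => G.wl (k + 1) u = t)
      (fun u => c ≤ idx u), Finset.filter_filter, Finset.filter_filter]
  gcongr
  have hsub : (Finset.univ.filter fun u => G.wl (k + 1) u = t ∧ ¬ c ≤ idx u) ⊆
      Finset.univ.filter fun u => G.wl k u = t.1 ∧ idx u < c := by
    intro u
    simp only [Finset.mem_filter, Finset.mem_univ, true_and, not_le]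
    exact fun hu => ⟨congrArg Prod.fst hu.1, hu.2⟩
  refine (Finset.card_le_card hsub).trans ?_
  rcases le_total c (Finset.univ.filter fun u => G.wl k u = t.1).card with hle | hle
  · exact (h t.1 c hle).le
  · refine (Finset.card_le_card fun u hu => ?_).trans hle
    simp only [Finset.mem_filter, Finset.mem_univ, true_and] at hu ⊢
    exact hu.1

end FeaturedGraph

/-! ### Captured classifiers see the census only up to a threshold -/

theorem FOClassifier.sat_iff_of_census_eq {d c : ℕ} {A : Set (Fin d → Bool)} {φ : FOClassifier d}
    {N : ACRGNN d} (hN : CapturedBy A c φ N) {k : ℕ} (hk : N.L ≤ k) {V W : Type} [Fintype V]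
    [Fintype W] {G : FeaturedGraph d V} {H : FeaturedGraph d W} (hGA : G.FeaturesIn A)
    (hGc : G.DegreeAtMost c) (hHA : H.FeaturesIn A) (hHc : H.DegreeAtMost c)
    (hcen : G.census k = H.census k) {v : V} {w : W} (h : G.wl k v = H.wl k w) :
    φ.Sat G v ↔ φ.Sat H w := by
  rw [← hN V G hGA hGc v, ← hN W H hHA hHc w]
  exact FeaturedGraph.accepts_iff_of_census_eq N hk hcen h

open Classical in
/-- A captured first-order classifier does not notice that frequent colours get more frequent. -/
theorem CapturedBy.exists_census_cons {d c : ℕ} {A : Set (Fin d → Bool)} {φ : FOClassifier d}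
    {N : ACRGNN d} (hN : CapturedBy A c φ N) :
    ∃ K : ℕ, ∀ (V : Type) [Fintype V] (G : FeaturedGraph d V), G.FeaturesIn A →
      G.DegreeAtMost c → ∀ (v : V) (t : WLType d (N.L + 1)),
      K ≤ (G.census (N.L + 1)).count t →
      ∃ (W : Type) (_ : Fintype W) (H : FeaturedGraph d W) (w : W), H.FeaturesIn A ∧
        H.DegreeAtMost c ∧ H.census (N.L + 1) = t ::ₘ G.census (N.L + 1) ∧
        H.wl (N.L + 1) w = G.wl (N.L + 1) v ∧ (φ.Sat G v ↔ φ.Sat H w) := by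
  obtain ⟨K, hK⟩ := FeaturedGraph.exists_realize_addTwin_iff φ
  -- Up to `c` vertices of colour `t` may have a small index, and one more is lost because the twins
  -- must avoid `v`.
  refine ⟨K + 2 + c, fun V _ G hA hc v t ht => ?_⟩
  obtain ⟨idx, hidx⟩ := Finset.exists_index_fibre (G.wl N.L)
  have hidx : G.IsIndex N.L idx := hidx
  set S := Finset.univ.filter fun u => G.wl (N.L + 1) u = t ∧ c ≤ idx u with hS
  have hcard : K + 2 ≤ S.card := by
    have := FeaturedGraph.card_twins (c := c) hidx t
    rw [← hS] at this
    omega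
  obtain ⟨w, hw⟩ : S.Nonempty := Finset.card_pos.1 (by omega)
  have hwt : G.wl (N.L + 1) w = t := (Finset.mem_filter.1 hw).2.1
  have hA' : (G.rewire N.L idx).FeaturesIn A := hA
  have hc' := FeaturedGraph.degreeAtMost_rewire hidx hc
  have hwl := FeaturedGraph.wl_rewire hidx
  have hcen : (G.rewire N.L idx).census (N.L + 1) = G.census (N.L + 1) := by
    rw [FeaturedGraph.census, hwl, FeaturedGraph.census]
  refine ⟨Option V, inferInstance, (G.rewire N.L idx).addTwin w, some v,
    fun a => hA' (a.getD w), hc'.addTwin w, ?_, ?_, ?_⟩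
  · rw [FeaturedGraph.census_addTwin, hcen, hwl, hwt]
  · rw [FeaturedGraph.wl_addTwin, hwl, Option.getD_some]
  -- Passing to the rewired graph is justified by the network, passing on to the graph with one more
  -- twin by first-order logic.
  · refine (FOClassifier.sat_iff_of_census_eq hN N.L.le_succ hA hc hA' hc' hcen.symm
      (congrFun hwl.symm v)).trans ?_
    have h1 := hK V (G.rewire N.L idx) w (S.erase v) (fun _ => v) default
      (by have := S.pred_card_le_card_erase (a := v); omega) fun a ha => by
        obtain ⟨hav, ha⟩ := Finset.mem_erase.1 ha
        obtain ⟨-, ha1, ha2⟩ := Finset.mem_filter.1 ha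
        exact ⟨FeaturedGraph.isTwin_rewire hc (ha1.trans hwt.symm) ha2, fun _ => hav.symm,
          fun i => i.elim0⟩
    unfold FOClassifier.Sat Formula.Realize
    convert h1 using 1
    congr!

-- Adding vertices one at a time works with a fixed `K`, since the counts only grow.
open Classical in
theorem CapturedBy.exists_census_add {d c : ℕ} {A : Set (Fin d → Bool)} {φ : FOClassifier d}
    {N : ACRGNN d} (hN : CapturedBy A c φ N) :
    ∃ K : ℕ, ∀ (D : Multiset (WLType d (N.L + 1))) (V : Type) [Fintype V]
      (G : FeaturedGraph d V), G.FeaturesIn A → G.DegreeAtMost c → ∀ v : V,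
      (∀ t ∈ D, K ≤ (G.census (N.L + 1)).count t) →
      ∃ (W : Type) (_ : Fintype W) (H : FeaturedGraph d W) (w : W), H.FeaturesIn A ∧
        H.DegreeAtMost c ∧ H.census (N.L + 1) = D + G.census (N.L + 1) ∧
        H.wl (N.L + 1) w = G.wl (N.L + 1) v ∧ (φ.Sat G v ↔ φ.Sat H w) := by
  obtain ⟨K, hK⟩ := hN.exists_census_cons
  refine ⟨K, fun D => ?_⟩
  induction D using Multiset.induction with
  | empty =>
    intro V _ G hA hc v _
    exact ⟨V, inferInstance, G, v, hA, hc, (zero_add _).symm, rfl, Iff.rfl⟩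
  | cons t D ih =>
    intro V _ G hA hc v hD
    obtain ⟨W, _, H, w, hA', hc', hcen, hwl, hφ⟩ :=
      ih V G hA hc v fun s hs => hD s (Multiset.mem_cons_of_mem hs)
    obtain ⟨W', i', H', w', hA'', hc'', hcen', hwl', hφ'⟩ := hK W H hA' hc' w t (by
      rw [hcen, Multiset.count_add]
      exact (hD t (Multiset.mem_cons_self _ _)).trans (Nat.le_add_left _ _))
    exact ⟨W', i', H', w', hA'', hc'', by rw [hcen', hcen, Multiset.cons_add],
      hwl'.trans hwl, hφ.trans hφ'⟩

open Classical in
/-- A captured first-order classifier depends on the colour of the vertex and on the numbers of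
vertices of each colour, cut off at some threshold. -/
theorem CapturedBy.exists_threshold {d c : ℕ} {A : Set (Fin d → Bool)} {φ : FOClassifier d}
    {N : ACRGNN d} (hN : CapturedBy A c φ N) :
    ∃ K : ℕ, ∀ (V W : Type) [Fintype V] [Fintype W] (G : FeaturedGraph d V)
      (H : FeaturedGraph d W), G.FeaturesIn A → G.DegreeAtMost c → H.FeaturesIn A →
      H.DegreeAtMost c → ∀ (v : V) (w : W), G.wl (N.L + 1) v = H.wl (N.L + 1) w →
      (∀ t, min K ((G.census (N.L + 1)).count t) = min K ((H.census (N.L + 1)).count t)) →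
      (φ.Sat G v ↔ φ.Sat H w) := by
  obtain ⟨K, hK⟩ := hN.exists_census_add
  refine ⟨K, fun V W _ _ G H hGA hGc hHA hHc v w hvw hcen => ?_⟩
  -- Each graph receives the colours it lacks relative to the other, so both censuses become their
  -- pointwise maximum. A colour whose counts differ occurs at least `K` times in both, as the
  -- truncated counts agree.
  obtain ⟨V', _, G', v', hGA', hGc', hG', hv', hφ⟩ :=
    hK (H.census (N.L + 1) - G.census (N.L + 1)) V G hGA hGc v fun t ht => by
      have h1 := hcen t
      have h2 := Multiset.count_pos.2 ht
      rw [Multiset.count_sub] at h2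
      omega
  obtain ⟨W', _, H', w', hHA', hHc', hH', hw', hφ'⟩ :=
    hK (G.census (N.L + 1) - H.census (N.L + 1)) W H hHA hHc w fun t ht => by
      have h1 := hcen t
      have h2 := Multiset.count_pos.2 ht
      rw [Multiset.count_sub] at h2
      omega
  rw [hφ, hφ']
  refine FOClassifier.sat_iff_of_census_eq hN N.L.le_succ hGA' hGc' hHA' hHc' ?_
    (hv'.trans (hvw.trans hw'.symm))
  rw [hG', hH']
  ext t
  simp only [Multiset.count_add, Multiset.count_sub]
  omega

/-! ### Definability of colours and of finitely determined properties -/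

/-- Membership of pointed graphs of degree at most `c` in `P` is expressed by a formula. -/
def IsDefinable {d : ℕ} (c : ℕ)
    (P : ∀ (V : Type) [Fintype V], FeaturedGraph d V → V → Prop) : Prop :=
  ∃ ψ : GMLE d, ∀ (V : Type) [Fintype V] (G : FeaturedGraph d V), G.DegreeAtMost c →
    ∀ v, P V G v ↔ ψ.Sat G v

namespace IsDefinable

variable {d c : ℕ} {P Q : ∀ (V : Type) [Fintype V], FeaturedGraph d V → V → Prop}

theorem const_true : IsDefinable (d := d) c fun _ _ _ _ => True :=
  ⟨.top, fun _ _ _ _ _ => Iff.rfl⟩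

theorem feat (i : Fin d) : IsDefinable c fun _ _ G v => G.feat v i = true :=
  ⟨.prop i, fun _ _ _ _ _ => Iff.rfl⟩

theorem not (hP : IsDefinable c P) : IsDefinable c fun V _ G v => ¬ P V G v := by
  obtain ⟨ψ, hψ⟩ := hP
  exact ⟨ψ.neg, fun V _ G hG v => not_congr (hψ V G hG v)⟩

theorem and (hP : IsDefinable c P) (hQ : IsDefinable c Q) :
    IsDefinable c fun V _ G v => P V G v ∧ Q V G v := by
  obtain ⟨ψ, hψ⟩ := hP
  obtain ⟨χ, hχ⟩ := hQ
  exact ⟨ψ.and χ, fun V _ G hG v => and_congr (hψ V G hG v) (hχ V G hG v)⟩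

theorem congr (hP : IsDefinable c P) (h : ∀ (V : Type) [Fintype V] (G : FeaturedGraph d V),
    G.DegreeAtMost c → ∀ v, Q V G v ↔ P V G v) : IsDefinable c Q := by
  obtain ⟨ψ, hψ⟩ := hP
  exact ⟨ψ, fun V _ G hG v => (h V G hG v).trans (hψ V G hG v)⟩

theorem or (hP : IsDefinable c P) (hQ : IsDefinable c Q) :
    IsDefinable c fun V _ G v => P V G v ∨ Q V G v :=
  (hP.not.and hQ.not).not.congr fun _ _ _ _ _ => or_iff_not_and_not

open Classical in
theorem dia (hP : IsDefinable c P) (k : ℕ) :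
    IsDefinable c fun V _ G v => k ≤ ((G.outNbhd v).filter fun u => P V G u).card := by
  obtain ⟨ψ, hψ⟩ := hP
  refine ⟨ψ.dia k, fun V _ G hG v => ?_⟩
  simp only [GMLE.Sat, hψ V G hG]

open Classical in
theorem ex (hP : IsDefinable c P) (k : ℕ) :
    IsDefinable c fun V _ G _ => k ≤ ((Finset.univ : Finset V).filter fun u => P V G u).card := by
  obtain ⟨ψ, hψ⟩ := hP
  refine ⟨ψ.ex k, fun V _ G hG v => ?_⟩
  simp only [GMLE.Sat, hψ V G hG]

/-- A property of the pointed graphs with features in `A` that is determined by finitely many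
formulas is expressed by a formula. -/
theorem of_determined {A : Set (Fin d → Bool)} (F : List (GMLE d))
    (P : ∀ (V : Type) [Fintype V], FeaturedGraph d V → V → Prop)
    (h : ∀ (V W : Type) [Fintype V] [Fintype W] (G : FeaturedGraph d V) (H : FeaturedGraph d W),
      G.FeaturesIn A → G.DegreeAtMost c → H.FeaturesIn A → H.DegreeAtMost c → ∀ (v : V) (w : W),
      (∀ ψ ∈ F, (ψ.Sat G v ↔ ψ.Sat H w)) → P V G v → P W H w) :
    ∃ Q : ∀ (V : Type) [Fintype V], FeaturedGraph d V → V → Prop, IsDefinable c Q ∧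
      ∀ (V : Type) [Fintype V] (G : FeaturedGraph d V), G.FeaturesIn A → G.DegreeAtMost c →
      ∀ v, P V G v ↔ Q V G v := by
  induction F generalizing P with
  | nil =>
    by_cases hP : ∃ (V : Type) (_ : Fintype V) (G : FeaturedGraph d V) (v : V),
      G.FeaturesIn A ∧ G.DegreeAtMost c ∧ P V G v
    · obtain ⟨V, _, G, v, hA, hc, hv⟩ := hP
      refine ⟨_, const_true, fun W _ H hA' hc' w => iff_true_intro ?_⟩
      exact h V W G H hA hc hA' hc' v w (by simp) hv
    · refine ⟨_, const_true.not, fun W _ H hA' hc' w => ?_⟩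
      simpa using fun hw => hP ⟨W, inferInstance, H, w, hA', hc', hw⟩
  | cons ψ F ih =>
    -- `R b` closes the part of `P` where `ψ` has truth value `b` under agreement on `F`, so the
    -- induction hypothesis applies to it.
    let R (b : Prop) : ∀ (V : Type) [Fintype V], FeaturedGraph d V → V → Prop := fun V _ G v =>
      ∃ (W : Type) (_ : Fintype W) (H : FeaturedGraph d W) (w : W), H.FeaturesIn A ∧
        H.DegreeAtMost c ∧ (ψ.Sat H w ↔ b) ∧ (∀ χ ∈ F, (χ.Sat H w ↔ χ.Sat G v)) ∧ P W H w
    have key : ∀ b, ∃ Q : ∀ (V : Type) [Fintype V], FeaturedGraph d V → V → Prop,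
        IsDefinable c Q ∧ ∀ (V : Type) [Fintype V] (G : FeaturedGraph d V), G.FeaturesIn A →
        G.DegreeAtMost c → ∀ v, R b V G v ↔ Q V G v := fun b => ih (R b) (by
      rintro V V' _ _ G G' - - - - v v' hv ⟨W, i, H, w, hA, hc, hb, hF, hP⟩
      exact ⟨W, i, H, w, hA, hc, hb, fun χ hχ => (hF χ hχ).trans (hv χ hχ), hP⟩)
    obtain ⟨Q₁, hQ₁, h₁⟩ := key True
    obtain ⟨Q₂, hQ₂, h₂⟩ := key False
    have hψ : IsDefinable c fun V _ G v => ψ.Sat G v := ⟨ψ, fun _ _ _ _ _ => Iff.rfl⟩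
    refine ⟨_, (hψ.and hQ₁).or (hψ.not.and hQ₂), fun V _ G hA hc v => ?_⟩
    rw [← h₁ V G hA hc, ← h₂ V G hA hc]
    constructor
    · intro hP
      by_cases hv : ψ.Sat G v
      · exact .inl ⟨hv, V, inferInstance, G, v, hA, hc, iff_true_intro hv, fun _ _ => Iff.rfl, hP⟩
      · exact .inr ⟨hv, V, inferInstance, G, v, hA, hc, iff_false_intro hv, fun _ _ => Iff.rfl, hP⟩
    · rintro (⟨hv, W, _, H, w, hA', hc', hb, hF, hP⟩ | ⟨hv, W, _, H, w, hA', hc', hb, hF, hP⟩)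
      all_goals
        refine h W V H G hA' hc' hA hc w v ?_ hP
        rw [List.forall_mem_cons]
        exact ⟨by simp [hb, hv], hF⟩

end IsDefinable

/-- The colours of vertices of graphs of degree at most `c` form a finite set. -/
theorem WLType.exists_finset (d c k : ℕ) : ∃ S : Finset (WLType d k), ∀ (V : Type) [Fintype V]
    (G : FeaturedGraph d V), G.DegreeAtMost c → ∀ v, G.wl k v ∈ S := by
  classical
  induction k with
  | zero => exact ⟨(Finset.univ : Finset (Fin d → Bool)), fun _ _ _ _ _ =>
    Finset.mem_univ (α := Fin d → Bool) _⟩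
  | succ k ih =>
    obtain ⟨S, hS⟩ := ih
    -- A multiset of at most `c` colours from `S` is contained in `c` copies of `S`.
    refine ⟨S ×ˢ (c • S.val).powerset.toFinset, fun V _ G hG v => Finset.mem_product.2
      ⟨hS V G hG v, ?_⟩⟩
    rw [Multiset.mem_toFinset, Multiset.mem_powerset, Multiset.le_iff_count]
    intro s
    change Multiset.count s ((G.outNbhd v).val.map (G.wl k)) ≤ _
    rw [Multiset.count_nsmul]
    by_cases hs : s ∈ S
    · rw [Multiset.count_eq_one_of_mem S.nodup hs, mul_one]
      exact (Multiset.count_le_card _ _).trans (by simpa using hG v)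
    · rw [Multiset.count_eq_zero.2]
      · exact Nat.zero_le _
      · simp only [Multiset.mem_map, not_exists, not_and]
        rintro u - rfl
        exact hs (hS V G hG u)

theorem WLType.isDefinable {d c : ℕ} (k : ℕ) (t : WLType d k) :
    IsDefinable c fun _ _ G v => G.wl k v = t := by
  classical
  have hall : ∀ {ι : Type} (S : Finset ι)
      (Q : ι → ∀ (V : Type) [Fintype V], FeaturedGraph d V → V → Prop),
      (∀ i, IsDefinable c (Q i)) → IsDefinable c fun V _ G v => ∀ i ∈ S, Q i V G v := by
    intro ι S Q hQ
    induction S using Finset.induction_on with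
    | empty => exact IsDefinable.const_true.congr fun _ _ _ _ _ => by simp
    | insert a S _ ih => exact ((hQ a).and ih).congr fun _ _ _ _ _ => by simp
  induction k with
  | zero =>
    refine (hall (Finset.univ : Finset (Fin d)) (fun i _ _ G v => G.feat v i = t i)
      fun i => ?_).congr fun V _ G _ v => ?_
    · cases hi : t i
      · exact (IsDefinable.feat i).not.congr fun _ _ _ _ _ => by simp
      · exact (IsDefinable.feat i).congr fun _ _ _ _ _ => by simp
    · exact ⟨fun h i _ => congrFun h i, fun h => funext fun i => h i (Finset.mem_univ i)⟩
  | succ k ih =>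
    obtain ⟨S, hS⟩ := WLType.exists_finset d c k
    -- Exact counts are prescribed for the finitely many colours that can occur. Those in `t.2` are
    -- included because `t` is arbitrary and may contain colours outside `S`.
    refine ((ih t.1).and (hall (S ∪ t.2.toFinset) (fun s V _ G v =>
      t.2.count s ≤ ((G.outNbhd v).filter fun u => G.wl k u = s).card ∧
      ¬ t.2.count s + 1 ≤ ((G.outNbhd v).filter fun u => G.wl k u = s).card)
      fun s => ((ih s).dia _).and ((ih s).dia _).not)).congr fun V _ G hG v => ?_
    refine Prod.ext_iff.trans (and_congr_right fun _ => ?_)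
    change (G.outNbhd v).val.map (G.wl k) = t.2 ↔ _
    constructor
    · rintro h s -
      rw [← h, Finset.count_map_val]
      omega
    · intro h
      ext s
      by_cases hs : s ∈ S ∪ t.2.toFinset
      · have := h s hs
        rw [Finset.count_map_val]
        omega
      · simp only [Finset.mem_union, Multiset.mem_toFinset, not_or] at hs
        rw [Multiset.count_eq_zero.2 hs.2, Multiset.count_eq_zero.2]
        simp only [Multiset.mem_map, not_exists, not_and]
        rintro u - rfl
        exact hs.1 (hS V G hG u)

theorem CapturedBy.exists_equivalentTo {d c : ℕ} {A : Set (Fin d → Bool)} {φ : FOClassifier d}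
    {N : ACRGNN d} (hN : CapturedBy A c φ N) : ∃ ψ : GMLE d, EquivalentTo A c φ ψ := by
  classical
  obtain ⟨K, hK⟩ := hN.exists_threshold
  obtain ⟨S, hS⟩ := WLType.exists_finset d c (N.L + 1)
  choose χ hχ using WLType.isDefinable (d := d) (c := c) (N.L + 1)
  -- These formulas fix the colour of the vertex and the count of every possible colour truncated at
  -- `K`.
  let F : List (GMLE d) := S.toList.map χ ++
    (S ×ˢ Finset.range (K + 1)).toList.map fun p => (χ p.1).ex p.2
  obtain ⟨Q, ⟨ψ, hψ⟩, hQ⟩ := IsDefinable.of_determined (c := c) (A := A) F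
    (fun _ _ G v => φ.Sat G v) (by
      intro V W _ _ G H hGA hGc hHA hHc v w hF
      have h1 : ∀ t ∈ S, ((χ t).Sat G v ↔ (χ t).Sat H w) := fun t ht =>
        hF _ (List.mem_append_left _ (List.mem_map_of_mem (Finset.mem_toList.2 ht)))
      have h2 : ∀ t ∈ S, ∀ k ≤ K, (((χ t).ex k).Sat G v ↔ ((χ t).ex k).Sat H w) :=
        fun t ht k hk => hF _ (List.mem_append_right _ (List.mem_map.2 ⟨(t, k),
          Finset.mem_toList.2 (Finset.mem_product.2
            ⟨ht, Finset.mem_range.2 (Nat.lt_succ_of_le hk)⟩), rfl⟩))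
      refine (hK V W G H hGA hGc hHA hHc v w ?_ fun t => ?_).1
      · exact ((hχ _ W H hHc w).2 ((h1 _ (hS V G hGc v)).1 ((hχ _ V G hGc v).1 rfl))).symm
      · by_cases ht : t ∈ S
        · have h3 : ∀ k ≤ K, (k ≤ (G.census (N.L + 1)).count t ↔
              k ≤ (H.census (N.L + 1)).count t) := by
            intro k hk
            have h4 := h2 t ht k hk
            simp only [GMLE.Sat, ← hχ t V G hGc, ← hχ t W H hHc] at h4
            simpa only [FeaturedGraph.census, Finset.count_map_val] using h4
          apply le_antisymm
          · exact le_min (min_le_left _ _) ((h3 _ (min_le_left _ _)).1 (min_le_right _ _))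
          · exact le_min (min_le_left _ _) ((h3 _ (min_le_left _ _)).2 (min_le_right _ _))
        · have hz : ∀ {U : Type} [Fintype U] (J : FeaturedGraph d U), J.DegreeAtMost c →
              (J.census (N.L + 1)).count t = 0 := by
            intro U _ J hJ
            rw [Multiset.count_eq_zero]
            simp only [FeaturedGraph.census, Multiset.mem_map, not_exists, not_and]
            rintro u - rfl
            exact ht (hS U J hJ u)
          rw [hz G hGc, hz H hHc])
  exact ⟨ψ, fun V _ G hA hc v => (hQ V G hA hc v).trans (hψ V G hc v)⟩

theorem mainTheorem6 (d : ℕ) (A : Set (Fin d → Bool)) (c : ℕ) (φ : FOClassifier d) :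
    (∃ N : ACRGNN d, CapturedBy A c φ N) ↔ (∃ ψ : GMLE d, EquivalentTo A c φ ψ) := by
  constructor
  · rintro ⟨N, hN⟩
    exact hN.exists_equivalentTo
  · rintro ⟨ψ, hψ⟩
    obtain ⟨N, hN⟩ := ACRGNN.exists_accepts_iff_sat ψ
    exact ⟨N, fun V _ G hA hc v => (hN V G v).trans (hψ V G hA hc v).symm⟩
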